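/- Let $\lambda\in(0,1]$ and let $\mu$ be a $\lambda$-permuton, i.e. a Borel probability measure on $\mathbb R^2$ concentrated on $[0,\lambda]\times[0,1]$ whose first marginal distribution function is $F_x(x)=x/\lambda$ for $x\in[0,\lambda]$ and whose second marginal distribution function $F_y$ is continuous with $F_y(b)-F_y(a)\le (b-a)/\lambda$ for $0\le a<b\le 1$. (A generalized permuton is a $\lambda$-permuton for some $\lambda\in(0,1]$.) Then there exist integers $1\le m_n\le n$ and $(n,m_n)$-permutations $\nu_n=(\nu_n(1),\dots,\nu_n(m_n))$, $n=1,2,\dots$ (sequences of $m_n$ distinct elements of $\{1,\dots,n\}$), with $m_n\to\infty$ and $m_n/n\to\lambda$, such that $\nu_n\xrightarrow{t}\mu$ as $n\to\infty$. That is, if $\mu_n$ denotes the generalized permuton corresponding to $\nu_n$, namely the measure with density $n^2/m_n$ on $\bigcup_{h=1}^{m_n}\left[\frac{h-1}{n},\frac hn\right)\times\left[\frac{\nu_n(h)-1}{n},\frac{\nu_n(h)}{n}\right)$ and density $0$ elsewhere, then for every $k$ and every permutation $\tau$ of $\{1,\dots,k\}$ $$\lim_{n\to\infty}t(\tau,\nu_n)=\lim_{n\to\infty}t(\tau,\mu_n)=t(\tau,\mu),$$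 and the two marginal distribution functions of $\mu_n$ (which are by definition those of $\nu_n$) converge weakly to $F_x$ and $F_y$, respectively. Here, for a generalized permuton $\rho$, $t(\tau,\rho)$ is the probability that $k$ independent points with distribution $\rho$ form the pattern $\tau$, i.e. that for every $i$ the point with the $i$-th smallest abscissa has the $\tau(i)$-th smallest ordinate. For an $(n,m)$-permutation $\nu$ and $k\le m$, $t(\tau,\nu)$ is the number of $x_1<\dots<x_k$ in $\{1,\dots,m\}$ such that $\nu(x_i)<\nu(x_j)\Leftrightarrow\tau(i)<\tau(j)$ for all $i,j$, divided by $\binom mk$. -/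

import Mathlib

open MeasureTheory ProbabilityTheory Filter Topology Set

noncomputable section

/-- An `(n,m)`-permutation: an ordered selection without replacement of `m` elements of an
`n`-element set. Positions and values are numbered from `0`. -/
abbrev OrderedSelection (n m : ℕ) : Type := Fin m ↪ Fin n

/-- The distribution function of the first marginal of a measure on the plane. -/
def marginalX (μ : Measure (ℝ × ℝ)) (x : ℝ) : ℝ := cdf (μ.map Prod.fst) x

/-- The distribution function of the second marginal of a measure on the plane. -/
def marginalY (μ : Measure (ℝ × ℝ)) (y : ℝ) : ℝ := cdf (μ.map Prod.snd) y

/-- `μ` is a `lam`-permuton. -/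
structure IsLambdaPermuton (lam : ℝ) (μ : Measure (ℝ × ℝ)) : Prop where
  lam_pos : 0 < lam
  lam_le_one : lam ≤ 1
  isProbabilityMeasure : IsProbabilityMeasure μ
  concentrated : μ (Icc 0 lam ×ˢ Icc 0 1)ᶜ = 0
  marginalX_eq : ∀ x ∈ Icc (0 : ℝ) lam, marginalX μ x = x / lam
  marginalY_continuous : Continuous (marginalY μ)
  marginalY_slope : ∀ a b : ℝ, 0 ≤ a → a < b → b ≤ 1 →
    marginalY μ b - marginalY μ a ≤ (b - a) / lam

/-- The square of side `1 / n` in column `h` and row `l`, both numbered from `0`. -/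
def gridSquare (n h l : ℕ) : Set (ℝ × ℝ) :=
  Ico ((h : ℝ) / n) (((h : ℝ) + 1) / n) ×ˢ Ico ((l : ℝ) / n) (((l : ℝ) + 1) / n)

open Classical in
/-- The density function attached to an `(n,m)`-permutation. -/
def selectionDensity {n m : ℕ} (ν : OrderedSelection n m) (p : ℝ × ℝ) : ℝ :=
  if ∃ h : Fin m, p ∈ gridSquare n h (ν h) then (n : ℝ) ^ 2 / m else 0

/-- The generalized permuton corresponding to an `(n,m)`-permutation. -/
def selectionPermuton {n m : ℕ} (ν : OrderedSelection n m) : Measure (ℝ × ℝ) :=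
  (volume : Measure (ℝ × ℝ)).withDensity fun p => ENNReal.ofReal (selectionDensity ν p)

/-- The sample `s` of `k` points has pairwise distinct abscissas and pairwise distinct ordinates,
and the permutation read off from it is `τ`: the `i`-th smallest abscissa is that of the point
`s (π i)`, the `j`-th smallest ordinate is that of the point `s (ρ j)`, and the point with the
`i`-th smallest abscissa is the one with the `τ i`-th smallest ordinate. -/
def SampleHasPattern {k : ℕ} (s : Fin k → ℝ × ℝ) (τ : Equiv.Perm (Fin k)) : Prop :=
  ∃ π ρ : Equiv.Perm (Fin k),
    StrictMono (fun i => (s (π i)).1) ∧ StrictMono (fun j => (s (ρ j)).2) ∧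
      ∀ i, π i = ρ (τ i)

/-- The density of the permutation `τ` of order `k` in `μ`: the probability that `k` independent
points with distribution `μ` have pattern `τ`. -/
def permutonDensity {k : ℕ} (τ : Equiv.Perm (Fin k)) (μ : Measure (ℝ × ℝ)) : ℝ :=
  (Measure.pi fun _ : Fin k => μ).real {s | SampleHasPattern s τ}

/-- The number of occurrences of the permutation `τ` in the `(n,m)`-permutation `ν`. -/
def patternCount {k n m : ℕ} (τ : Equiv.Perm (Fin k)) (ν : OrderedSelection n m) : ℕ :=
  Nat.card {x : Fin k → Fin m //
    StrictMono x ∧ ∀ i j, ν (x i) < ν (x j) ↔ τ i < τ j}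

/-- The density of the permutation `τ` in the `(n,m)`-permutation `ν` (used for `k ≤ m`). -/
def selectionPatternDensity {k n m : ℕ} (τ : Equiv.Perm (Fin k)) (ν : OrderedSelection n m) : ℝ :=
  (patternCount τ ν : ℝ) / (m.choose k : ℝ)

/-- Weak convergence of distribution functions on the line: convergence at every continuity point
of the limit. -/
def DistributionTendsto (F : ℕ → ℝ → ℝ) (G : ℝ → ℝ) : Prop :=
  ∀ x, ContinuousAt G x → Tendsto (fun n => F n x) atTop (𝓝 (G x))

/-- Convergence of generalized permutons in the sense of permutation densities. -/
structure PermutonTendsto (μs : ℕ → Measure (ℝ × ℝ)) (μ : Measure (ℝ × ℝ)) : Prop where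
  density : ∀ (k : ℕ) (τ : Equiv.Perm (Fin k)),
    Tendsto (fun n => permutonDensity τ (μs n)) atTop (𝓝 (permutonDensity τ μ))
  marginalX : DistributionTendsto (fun n => marginalX (μs n)) (marginalX μ)
  marginalY : DistributionTendsto (fun n => marginalY (μs n)) (marginalY μ)

/-- The sequence `ν n` of `(n, m n)`-permutations converges to the `lam`-permuton `μ`: the lengths
`m n` tend to infinity with `m n / n → lam`, the permutation densities of `ν n` converge to those
of `μ`, and the generalized permutons corresponding to `ν n` converge to `μ` in the sense of
permutation densities. The marginal distribution functions of `ν n` are by definition those of the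
corresponding generalized permuton, so that their convergence is contained in the last clause. -/
structure SelectionTendsto {m : ℕ → ℕ} (ν : ∀ n, OrderedSelection n (m n)) (lam : ℝ)
    (μ : Measure (ℝ × ℝ)) : Prop where
  length_tendsto : Tendsto m atTop atTop
  ratio_tendsto : Tendsto (fun n => (m n : ℝ) / (n : ℝ)) atTop (𝓝 lam)
  density : ∀ (k : ℕ) (τ : Equiv.Perm (Fin k)),
    Tendsto (fun n => selectionPatternDensity τ (ν n)) atTop (𝓝 (permutonDensity τ μ))
  permuton_tendsto : PermutonTendsto (fun n => selectionPermuton (ν n)) μ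

end

/-! Everything is reduced to weak convergence of the generalized permutons of `ν n`, measured by the
Lévy–Prokhorov distance, with `m n = ⌈lam * n⌉₊`.

Construction (`exists_selection_levyProkhorovEDist_le`): cut `(0, lam] × (0, 1]` into `r ^ 2`
congruent cells. A vertical strip has mass at most `1 / r`, and a horizontal one at most `1 / (r *
lam)` by the slope condition. Hence, for a suitable `N` close to `m`, the integers `⌊N * μ(cell)⌋`
are few enough for the points of each strip to get distinct columns and distinct rows in the
matching blocks of the `n × n` grid. The remaining points are placed arbitrarily. The result is
within `max (2 / r) (r ^ 2 * (r + 2) / m)` of `μ`.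

Weak convergence gives convergence of densities (`tendsto_permutonDensity`): the pattern events are
open, disjoint and jointly of full measure because the marginals of `μ` have no atoms, so their
boundaries are null. The same absence of atoms gives convergence of the marginal distribution
functions.

Finally (`tendsto_selectionPatternDensity`) the density of `τ` in `ν n` is at most that in its
permuton times a factor tending to `1`. Since the limits sum to `1`, these one-sided bounds force
equality in the limit. -/

/-! ### Patterns of samples: uniqueness and almost sure existence. -/

theorem injective_of_strictMono_comp_perm {ι α : Type*} [LinearOrder ι] [Preorder α] {f : ι → α}
    {π : Equiv.Perm ι} (h : StrictMono fun i => f (π i)) : Function.Injective f := by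
  intro a b hab
  have := h.injective (a₁ := π.symm a) (a₂ := π.symm b) (by simpa using hab)
  simpa using this

theorem eq_of_strictMono_comp_perm {k : ℕ} {α : Type*} [PartialOrder α] {f : Fin k → α}
    {π ρ : Equiv.Perm (Fin k)} (hπ : StrictMono fun i => f (π i))
    (hρ : StrictMono fun i => f (ρ i)) : π = ρ := by
  ext i : 1
  exact injective_of_strictMono_comp_perm hπ
    (congrFun (Tuple.unique_monotone (f := f) hπ.monotone hρ.monotone) i)

theorem SampleHasPattern.unique {k : ℕ} {s : Fin k → ℝ × ℝ} {τ σ : Equiv.Perm (Fin k)}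
    (hτ : SampleHasPattern s τ) (hσ : SampleHasPattern s σ) : τ = σ := by
  obtain ⟨π, ρ, hπ, hρ, h⟩ := hτ
  obtain ⟨π', ρ', hπ', hρ', h'⟩ := hσ
  obtain rfl := eq_of_strictMono_comp_perm (f := fun i => (s i).1) hπ hπ'
  obtain rfl := eq_of_strictMono_comp_perm (f := fun i => (s i).2) hρ hρ'
  ext i : 1
  exact ρ.injective ((h i).symm.trans (h' i))

theorem exists_sampleHasPattern {k : ℕ} {s : Fin k → ℝ × ℝ}
    (hx : Function.Injective fun i => (s i).1) (hy : Function.Injective fun i => (s i).2) :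
    ∃ τ, SampleHasPattern s τ := by
  refine ⟨(Tuple.sort fun i => (s i).1).trans (Tuple.sort fun i => (s i).2).symm,
    Tuple.sort fun i => (s i).1, Tuple.sort fun i => (s i).2, ?_, ?_, fun i => by simp⟩
  · exact (Tuple.monotone_sort fun i => (s i).1).strictMono_of_injective
      (hx.comp (Equiv.injective _))
  · exact (Tuple.monotone_sort fun i => (s i).2).strictMono_of_injective
      (hy.comp (Equiv.injective _))

theorem isOpen_setOf_sampleHasPattern {k : ℕ} (τ : Equiv.Perm (Fin k)) :
    IsOpen {s : Fin k → ℝ × ℝ | SampleHasPattern s τ} := by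
  simp only [SampleHasPattern, StrictMono, ofPred_exists, ofPred_and, ofPred_forall]
  refine isOpen_iUnion fun π => isOpen_iUnion fun ρ => IsOpen.inter ?_ (IsOpen.inter ?_ ?_)
  · exact isOpen_iInter_of_finite fun i => isOpen_iInter_of_finite fun j =>
      isOpen_iInter_of_finite fun _ => isOpen_lt (by fun_prop) (by fun_prop)
  · exact isOpen_iInter_of_finite fun i => isOpen_iInter_of_finite fun j =>
      isOpen_iInter_of_finite fun _ => isOpen_lt (by fun_prop) (by fun_prop)
  · exact isOpen_iInter_of_finite fun i => isOpen_const

/-- Two distinct coordinates are independent with a common atomless law, and a product of atomless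
laws does not charge the diagonal. -/
theorem measure_pi_coordinate_eq {k : ℕ} (μ : Measure (ℝ × ℝ)) [IsProbabilityMeasure μ]
    {f : ℝ × ℝ → ℝ} (hf : Measurable f) [NullSingletonClass (μ.map f)] {i j : Fin k} (hij : i ≠ j) :
    (Measure.pi fun _ : Fin k => μ) {s | f (s i) = f (s j)} = 0 := by
  have hind := (iIndepFun_pi (μ := fun _ : Fin k => μ) (X := fun _ => f)
    fun _ => hf.aemeasurable).indepFun hij
  have hmap (l : Fin k) : (Measure.pi fun _ : Fin k => μ).map (fun s => f (s l)) = μ.map f := by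
    conv_rhs => rw [← (measurePreserving_eval (fun _ : Fin k => μ) l).map_eq]
    exact (Measure.map_map hf (measurable_pi_apply l)).symm
  have hm (l : Fin k) : Measurable fun s : Fin k → ℝ × ℝ => f (s l) :=
    hf.comp (measurable_pi_apply l)
  have := (indepFun_iff_map_prod_eq_prod_map_map (hm i).aemeasurable (hm j).aemeasurable).1 hind
  rw [hmap, hmap] at this
  have hprob : IsProbabilityMeasure (μ.map f) := Measure.isProbabilityMeasure_map hf.aemeasurable
  have hdiag : MeasurableSet {p : ℝ × ℝ | p.1 = p.2} :=
    measurableSet_eq_fun measurable_fst measurable_snd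
  have h0 : ((μ.map f).prod (μ.map f)) {p : ℝ × ℝ | p.1 = p.2} = 0 := by
    rw [Measure.prod_apply hdiag]
    simp
  rw [← this, Measure.map_apply ((hm i).prodMk (hm j)) hdiag] at h0
  exact h0

theorem ae_exists_sampleHasPattern {k : ℕ} (μ : Measure (ℝ × ℝ)) [IsProbabilityMeasure μ]
    [NullSingletonClass (μ.map Prod.fst)] [NullSingletonClass (μ.map Prod.snd)] :
    ∀ᵐ s ∂(Measure.pi fun _ : Fin k => μ), ∃ τ, SampleHasPattern s τ := by
  have key {f : ℝ × ℝ → ℝ} (hf : Measurable f) (h : NullSingletonClass (μ.map f)) :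
      ∀ᵐ s ∂(Measure.pi fun _ : Fin k => μ), ∀ i j, i ≠ j → f (s i) ≠ f (s j) := by
    simp only [ae_all_iff]
    intro i j hij
    rw [ae_iff]
    simpa using measure_pi_coordinate_eq μ hf hij
  filter_upwards [key measurable_fst inferInstance, key measurable_snd inferInstance] with s hx hy
  exact exists_sampleHasPattern (fun i j h => by_contra fun hij => hx i j hij h)
    (fun i j h => by_contra fun hij => hy i j hij h)

theorem sum_permutonDensity (k : ℕ) (μ : Measure (ℝ × ℝ)) [IsProbabilityMeasure μ]
    [NullSingletonClass (μ.map Prod.fst)] [NullSingletonClass (μ.map Prod.snd)] :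
    ∑ τ : Equiv.Perm (Fin k), permutonDensity τ μ = 1 := by
  unfold permutonDensity
  have hU : (⋃ τ ∈ (Finset.univ : Finset (Equiv.Perm (Fin k))),
      {s : Fin k → ℝ × ℝ | SampleHasPattern s τ}) =ᵐ[Measure.pi fun _ : Fin k => μ] univ := by
    filter_upwards [ae_exists_sampleHasPattern (k := k) μ] with s hs
    exact propext ⟨fun _ => trivial, fun _ => mem_iUnion₂.2 (by simpa using hs)⟩
  rw [← measureReal_biUnion_finset, measureReal_congr hU]
  · simp
  · intro τ _ σ _ hne
    exact Set.disjoint_left.2 fun s hτ hσ => hne (hτ.unique hσ)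
  · exact fun τ _ => (isOpen_setOf_sampleHasPattern τ).measurableSet

/-! ### Consequences of weak convergence. -/

theorem tendsto_permutonDensity {ι : Type*} {l : Filter ι} {μs : ι → ProbabilityMeasure (ℝ × ℝ)}
    {μ : ProbabilityMeasure (ℝ × ℝ)} (h : Tendsto μs l (𝓝 μ))
    [NullSingletonClass ((μ : Measure (ℝ × ℝ)).map Prod.fst)] [NullSingletonClass ((μ : Measure (ℝ × ℝ)).map Prod.snd)]
    {k : ℕ} (τ : Equiv.Perm (Fin k)) :
    Tendsto (fun n => permutonDensity τ (μs n : Measure (ℝ × ℝ))) l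
      (𝓝 (permutonDensity τ (μ : Measure (ℝ × ℝ)))) := by
  have hpi : Tendsto (fun n => ProbabilityMeasure.pi fun _ : Fin k => μs n) l
      (𝓝 (ProbabilityMeasure.pi fun _ : Fin k => μ)) :=
    (ProbabilityMeasure.continuous_pi.tendsto _).comp (tendsto_pi_nhds.2 fun _ => h)
  -- The pattern events are open and pairwise disjoint, so the boundary of one of them misses them
  -- all and lies in the null set of samples without a pattern.
  have hfr : (ProbabilityMeasure.pi (fun _ : Fin k => μ) : Measure (Fin k → ℝ × ℝ))
      (frontier {s | SampleHasPattern s τ}) = 0 := by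
    refine measure_mono_null ?_ (ae_iff.1 (ae_exists_sampleHasPattern (k := k)
      (μ : Measure (ℝ × ℝ))))
    rintro s hs ⟨σ, hσ⟩
    rw [(isOpen_setOf_sampleHasPattern τ).frontier_eq] at hs
    obtain ⟨t, ht, ht'⟩ := mem_closure_iff.1 hs.1 _ (isOpen_setOf_sampleHasPattern σ) hσ
    exact hs.2 (ht.unique ht' ▸ hσ)
  exact (ENNReal.tendsto_toReal (measure_ne_top _ _)).comp
    (ProbabilityMeasure.tendsto_measure_of_null_frontier_of_tendsto' hpi hfr)

theorem nullSingletonClass_of_continuous_cdf (μ : Measure ℝ) [IsProbabilityMeasure μ]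
    (h : Continuous (cdf μ)) : NullSingletonClass μ := by
  refine ⟨fun x => ?_⟩
  rw [← measure_cdf μ, StieltjesFunction.measure_singleton,
    h.continuousAt.continuousWithinAt.leftLim_eq, sub_self, ENNReal.ofReal_zero]

theorem tendsto_cdf_map {ι : Type*} {l : Filter ι} {μs : ι → ProbabilityMeasure (ℝ × ℝ)}
    {μ : ProbabilityMeasure (ℝ × ℝ)} (h : Tendsto μs l (𝓝 μ)) {f : ℝ × ℝ → ℝ} (hf : Continuous f)
    [NullSingletonClass ((μ : Measure (ℝ × ℝ)).map f)] (x : ℝ) :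
    Tendsto (fun n => cdf ((μs n : Measure (ℝ × ℝ)).map f) x) l
      (𝓝 (cdf ((μ : Measure (ℝ × ℝ)).map f) x)) := by
  have hp (ρ : ProbabilityMeasure (ℝ × ℝ)) : IsProbabilityMeasure ((ρ : Measure (ℝ × ℝ)).map f) :=
    Measure.isProbabilityMeasure_map hf.measurable.aemeasurable
  have hmap : Tendsto (fun n => (μs n).map hf.measurable.aemeasurable) l
      (𝓝 (μ.map hf.measurable.aemeasurable)) :=
    ProbabilityMeasure.tendsto_map_of_tendsto_of_continuous μs μ h hf
  simp only [cdf_eq_real]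
  refine (ENNReal.tendsto_toReal (measure_ne_top _ _)).comp
    (ProbabilityMeasure.tendsto_measure_of_null_frontier_of_tendsto' hmap ?_)
  rw [frontier_Iic]
  exact measure_singleton (μ := (μ : Measure (ℝ × ℝ)).map f) x

/-! ### The generalized permuton of a selection. -/

theorem measurableSet_gridSquare (n h l : ℕ) : MeasurableSet (gridSquare n h l) :=
  measurableSet_Ico.prod measurableSet_Ico

theorem fst_eq_of_mem_gridSquare {n h l h' l' : ℕ} {p : ℝ × ℝ} (hp : p ∈ gridSquare n h l)
    (hp' : p ∈ gridSquare n h' l') : h = h' := by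
  have key {a b : ℕ} {x : ℝ} (ha : (a : ℝ) / n ≤ x) (hb : x < ((b : ℝ) + 1) / n) : a ≤ b := by
    -- For `n = 0` the divisions give `0` and the square is empty.
    have hn : (0 : ℝ) < n := by
      rcases n.eq_zero_or_pos with rfl | hn
      · simp at ha hb; linarith
      · exact_mod_cast hn
    have := (div_lt_div_iff_of_pos_right hn).1 (ha.trans_lt hb)
    exact Nat.lt_succ_iff.1 (by exact_mod_cast this)
  exact le_antisymm (key hp.1.1 hp'.1.2) (key hp'.1.1 hp.1.2)

theorem lt_of_mem_Ico_div {n a b : ℕ} {x y : ℝ} (hab : a < b)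
    (hx : x ∈ Ico ((a : ℝ) / n) (((a : ℝ) + 1) / n))
    (hy : y ∈ Ico ((b : ℝ) / n) (((b : ℝ) + 1) / n)) : x < y := by
  refine hx.2.trans_le (le_trans ?_ hy.1)
  have : (a : ℝ) + 1 ≤ b := by exact_mod_cast hab
  gcongr

theorem volume_gridSquare (n h l : ℕ) :
    volume (gridSquare n h l) = ENNReal.ofReal (1 / (n : ℝ) ^ 2) := by
  rw [gridSquare, Measure.volume_eq_prod, Measure.prod_prod, Real.volume_Ico, Real.volume_Ico,
    ← ENNReal.ofReal_mul (by rw [← sub_div]; simp)]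
  congr 1
  rw [← sub_div, ← sub_div]
  ring

theorem selectionPermuton_gridSquare {n m : ℕ} (hn : n ≠ 0) (ν : OrderedSelection n m)
    (h : Fin m) : selectionPermuton ν (gridSquare n h (ν h)) = (m : ENNReal)⁻¹ := by
  have hm : 0 < m := h.pos
  rw [selectionPermuton, withDensity_apply _ (measurableSet_gridSquare n h (ν h)),
    setLIntegral_congr_fun (g := fun _ => ENNReal.ofReal ((n : ℝ) ^ 2 / m))
      (measurableSet_gridSquare n h (ν h)) (fun p hp => by
        simp only [selectionDensity, if_pos (⟨h, hp⟩ : ∃ h : Fin m, p ∈ gridSquare n h (ν h))]),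
    setLIntegral_const, volume_gridSquare, ← ENNReal.ofReal_mul (by positivity)]
  have : (n : ℝ) ^ 2 / m * (1 / (n : ℝ) ^ 2) = (m : ℝ)⁻¹ := by
    field_simp
  rw [this, ENNReal.ofReal_inv_of_pos (by exact_mod_cast hm), ENNReal.ofReal_natCast]

theorem pairwise_disjoint_gridSquare {n m : ℕ} (ν : OrderedSelection n m) :
    Pairwise (Function.onFun Disjoint fun h : Fin m => gridSquare n h (ν h)) := fun _ _ hne =>
  Set.disjoint_left.2 fun _ hp hp' => hne (Fin.ext (fst_eq_of_mem_gridSquare hp hp'))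

theorem selectionPermuton_biUnion_gridSquare {n m : ℕ} (hn : n ≠ 0) (ν : OrderedSelection n m)
    (s : Finset (Fin m)) :
    selectionPermuton ν (⋃ h ∈ s, gridSquare n h (ν h)) = s.card * (m : ENNReal)⁻¹ := by
  rw [measure_biUnion_finset (fun i _ j _ hne => pairwise_disjoint_gridSquare ν hne)
    fun h _ => measurableSet_gridSquare n h (ν h)]
  simp [selectionPermuton_gridSquare hn]

theorem isProbabilityMeasure_selectionPermuton {n m : ℕ} (hn : n ≠ 0) (hm : m ≠ 0)
    (ν : OrderedSelection n m) : IsProbabilityMeasure (selectionPermuton ν) := by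
  have hU : MeasurableSet (⋃ h ∈ (Finset.univ : Finset (Fin m)), gridSquare n h (ν h)) :=
    Finset.measurableSet_biUnion _ fun h _ => measurableSet_gridSquare n h (ν h)
  refine ⟨?_⟩
  rw [← measure_add_measure_compl hU, selectionPermuton_biUnion_gridSquare hn]
  have : selectionPermuton ν (⋃ h ∈ (Finset.univ : Finset (Fin m)), gridSquare n h (ν h))ᶜ = 0 := by
    rw [selectionPermuton, withDensity_apply _ hU.compl]
    refine (setLIntegral_congr_fun (g := fun _ => 0) hU.compl fun p hp => ?_).trans (by simp)
    have : ¬∃ h : Fin m, p ∈ gridSquare n h (ν h) := by simpa using hp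
    simp [selectionDensity, this]
  rw [this, add_zero, Finset.card_univ, Fintype.card_fin]
  exact ENNReal.mul_inv_cancel (by exact_mod_cast hm) (ENNReal.natCast_ne_top m)

/-! ### Pattern counts against densities. -/

theorem sampleHasPattern_of_mem_gridSquare {k n m : ℕ} {ν : OrderedSelection n m}
    {τ π : Equiv.Perm (Fin k)} {x : Fin k → Fin m} (hx : StrictMono x)
    (hτ : ∀ i j, ν (x i) < ν (x j) ↔ τ i < τ j) {s : Fin k → ℝ × ℝ}
    (hs : ∀ i, s i ∈ gridSquare n (x (π.symm i)) (ν (x (π.symm i)))) : SampleHasPattern s τ := by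
  have hs' (i : Fin k) : s (π i) ∈ gridSquare n (x i) (ν (x i)) := by simpa using hs (π i)
  refine ⟨π, τ.symm.trans π, fun i j hij => ?_, fun i j hij => ?_, fun i => by simp⟩
  · exact lt_of_mem_Ico_div (hx hij) (hs' i).1 (hs' j).1
  · have : ν (x (τ.symm i)) < ν (x (τ.symm j)) := by simpa [hτ] using hij
    exact lt_of_mem_Ico_div this (hs' _).2 (hs' _).2

/-- An occurrence of `τ` together with an assignment of the `k` sample points to its squares gives a
box of mass `1 / m ^ k` inside the pattern event, and these boxes are disjoint. Only samples with
two points in one square are lost. -/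
theorem factorial_mul_patternCount_le {k n m : ℕ} (hn : n ≠ 0) (hm : m ≠ 0)
    (ν : OrderedSelection n m) (τ : Equiv.Perm (Fin k)) :
    (k.factorial * patternCount τ ν : ℝ) / (m : ℝ) ^ k
      ≤ permutonDensity τ (selectionPermuton ν) := by
  classical
  have := isProbabilityMeasure_selectionPermuton hn hm ν
  let A := Equiv.Perm (Fin k) × {x : Fin k → Fin m //
    StrictMono x ∧ ∀ i j, ν (x i) < ν (x j) ↔ τ i < τ j}
  let H : A → Fin k → Fin m := fun a i => a.2.1 (a.1.symm i)
  have hH : Function.Injective H := by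
    rintro ⟨π, x⟩ ⟨π', x'⟩ h
    -- The permutation is recovered as the one that sorts the tuple.
    have e : π = π' := by
      refine eq_of_strictMono_comp_perm (f := H ⟨π, x⟩) ?_ ?_
      · simpa [H] using x.2.1
      · rw [h]; simpa [H] using x'.2.1
    subst e
    refine Prod.ext rfl (Subtype.ext (funext fun i => ?_))
    simpa [H] using congrFun h (π i)
  let box : A → Set (Fin k → ℝ × ℝ) := fun a =>
    univ.pi fun i => gridSquare n (H a i) (ν (H a i))
  have hbox (a : A) : (Measure.pi fun _ : Fin k => selectionPermuton ν).real (box a)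
      = ((m : ℝ) ^ k)⁻¹ := by
    simp [box, measureReal_def, Measure.pi_pi, selectionPermuton_gridSquare hn]
  have hdisj : Pairwise (Function.onFun Disjoint box) := fun a b hne =>
    Set.disjoint_left.2 fun s ha hb => hne (hH (funext fun i => Fin.ext
      (fst_eq_of_mem_gridSquare (ha i trivial) (hb i trivial))))
  have hcard : (Fintype.card A : ℝ) = k.factorial * patternCount τ ν := by
    simp [A, patternCount, Fintype.card_perm]
  calc (k.factorial * patternCount τ ν : ℝ) / (m : ℝ) ^ k
      = ∑ a : A, (Measure.pi fun _ : Fin k => selectionPermuton ν).real (box a) := by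
        simp only [hbox, Finset.sum_const, Finset.card_univ, nsmul_eq_mul, hcard]
        rfl
    _ = (Measure.pi fun _ : Fin k => selectionPermuton ν).real (⋃ a ∈ Finset.univ, box a) :=
        (measureReal_biUnion_finset (fun a _ b _ hne => hdisj hne) fun a _ =>
          MeasurableSet.univ_pi fun i => measurableSet_gridSquare _ _ _).symm
    _ ≤ permutonDensity τ (selectionPermuton ν) := by
        refine measureReal_mono (iUnion₂_subset fun a _ s hs => ?_)
        exact sampleHasPattern_of_mem_gridSquare a.2.2.1 a.2.2.2 fun i => hs i trivial

theorem exists_perm_lt_iff {k : ℕ} {α : Type*} [LinearOrder α] {f : Fin k → α}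
    (hf : Function.Injective f) : ∃ τ : Equiv.Perm (Fin k), ∀ i j, f i < f j ↔ τ i < τ j := by
  have h : StrictMono fun i => f (Tuple.sort f i) :=
    (Tuple.monotone_sort f).strictMono_of_injective (hf.comp (Equiv.injective _))
  refine ⟨(Tuple.sort f).symm, fun i j => ?_⟩
  simpa using h.lt_iff_lt (a := (Tuple.sort f).symm i) (b := (Tuple.sort f).symm j)

theorem choose_le_sum_patternCount {n m : ℕ} (k : ℕ) (ν : OrderedSelection n m) :
    m.choose k ≤ ∑ τ : Equiv.Perm (Fin k), patternCount τ ν := by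
  classical
  have hx (x : {x : Fin k → Fin m // StrictMono x}) : ∃ τ : Equiv.Perm (Fin k),
      ∀ i j, ν (x.1 i) < ν (x.1 j) ↔ τ i < τ j :=
    exists_perm_lt_iff (f := fun i => ν (x.1 i)) (ν.injective.comp x.2.injective)
  choose t ht using hx
  let g : {s : Finset (Fin m) // s.card = k} →
      Σ τ : Equiv.Perm (Fin k), {x : Fin k → Fin m //
        StrictMono x ∧ ∀ i j, ν (x i) < ν (x j) ↔ τ i < τ j} := fun s =>
    ⟨t ⟨s.1.orderEmbOfFin s.2, (s.1.orderEmbOfFin s.2).strictMono⟩,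
      s.1.orderEmbOfFin s.2, (s.1.orderEmbOfFin s.2).strictMono,
      ht ⟨s.1.orderEmbOfFin s.2, (s.1.orderEmbOfFin s.2).strictMono⟩⟩
  have hg : Function.Injective g := by
    intro s s' h
    have := congrArg (fun a => range a.2.1) h
    simpa [g, Subtype.ext_iff] using this
  have := Fintype.card_le_of_injective g hg
  simpa [patternCount, Fintype.card_sigma] using this

theorem tendsto_descFactorial_div_pow (k : ℕ) {m : ℕ → ℕ} (hm : Tendsto m atTop atTop) :
    Tendsto (fun n => ((m n).descFactorial k : ℝ) / (m n : ℝ) ^ k) atTop (𝓝 1) := by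
  have h := (isEquivalent_descFactorial k).comp_tendsto hm
  refine (Asymptotics.isEquivalent_iff_tendsto_one ?_).1 h
  filter_upwards [hm.eventually_ne_atTop 0] with n hn
  simpa using fun h => absurd h hn

/-- A squeeze: the upper bound for `τ` is direct, and the lower bound follows from the upper bounds
for all other patterns, because the densities in `ν n` sum to at least `1` and the limits sum to
exactly `1`. -/
theorem tendsto_selectionPatternDensity {m : ℕ → ℕ} {ν : ∀ n, OrderedSelection n (m n)}
    (hm : Tendsto m atTop atTop) {k : ℕ} {t : Equiv.Perm (Fin k) → ℝ} (ht : ∑ τ, t τ = 1)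
    (h : ∀ τ : Equiv.Perm (Fin k),
      Tendsto (fun n => permutonDensity τ (selectionPermuton (ν n))) atTop (𝓝 (t τ)))
    (τ : Equiv.Perm (Fin k)) :
    Tendsto (fun n => selectionPatternDensity τ (ν n)) atTop (𝓝 (t τ)) := by
  classical
  have hr := tendsto_descFactorial_div_pow k hm
  set r : ℕ → ℝ := fun n => ((m n).descFactorial k : ℝ) / (m n : ℝ) ^ k
  have hub : ∀ᶠ n in atTop, ∀ τ : Equiv.Perm (Fin k),
      selectionPatternDensity τ (ν n) ≤ permutonDensity τ (selectionPermuton (ν n)) / r n := by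
    -- The bound `k + 1` instead of `k` keeps `m n` positive when `k = 0`.
    filter_upwards [eventually_ne_atTop 0, hm.eventually_ge_atTop (k + 1)] with n hn hmn τ
    have hd : (0 : ℝ) < (m n).descFactorial k := by
      exact_mod_cast Nat.descFactorial_pos.2 (by omega)
    have hm0 : (0 : ℝ) < m n := by exact_mod_cast (by omega : 0 < m n)
    have hk : (0 : ℝ) < k.factorial := by exact_mod_cast k.factorial_pos
    rw [le_div_iff₀ (div_pos hd (by positivity))]
    refine le_trans (le_of_eq ?_) (factorial_mul_patternCount_le hn (by omega) (ν n) τ)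
    rw [Nat.descFactorial_eq_factorial_mul_choose] at hd
    simp only [selectionPatternDensity]
    rw [Nat.descFactorial_eq_factorial_mul_choose]
    push_cast at hd ⊢
    have hc : ((m n).choose k : ℝ) ≠ 0 := (pos_of_mul_pos_right hd hk.le).ne'
    field_simp
  have hlim (σ : Equiv.Perm (Fin k)) : Tendsto (fun n =>
      permutonDensity σ (selectionPermuton (ν n)) / r n) atTop (𝓝 (t σ)) := by
    have := (h σ).div hr one_ne_zero
    rw [div_one] at this
    exact this
  have hlow : Tendsto (fun n => 1 - ∑ σ ∈ Finset.univ.erase τ,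
      permutonDensity σ (selectionPermuton (ν n)) / r n) atTop (𝓝 (t τ)) := by
    have := (tendsto_finsetSum (Finset.univ.erase τ) fun σ _ => hlim σ).const_sub 1
    rwa [show 1 - ∑ σ ∈ Finset.univ.erase τ, t σ = t τ by
      rw [← ht, ← Finset.add_sum_erase _ _ (Finset.mem_univ τ), add_sub_cancel_right]] at this
  refine tendsto_of_tendsto_of_tendsto_of_le_of_le' hlow (hlim τ) ?_ (hub.mono fun n hn => hn τ)
  filter_upwards [hub, hm.eventually_ge_atTop k] with n hn hmn
  have hsum : 1 ≤ ∑ σ : Equiv.Perm (Fin k), selectionPatternDensity σ (ν n) := by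
    have hc : (0 : ℝ) < (m n).choose k := by exact_mod_cast Nat.choose_pos hmn
    simp only [selectionPatternDensity]
    rw [← Finset.sum_div, le_div_iff₀ hc, one_mul]
    exact_mod_cast choose_le_sum_patternCount k (ν n)
  rw [← Finset.add_sum_erase _ _ (Finset.mem_univ τ)] at hsum
  have := Finset.sum_le_sum fun σ (_ : σ ∈ Finset.univ.erase τ) => hn σ
  linarith

/-! ### A Lévy–Prokhorov bound from matched cells. -/

/-- The cells `C i` meeting a set `B` carry its mass, the matched sets `D i` lie near `B`, and each
match loses at most `η`. Between probability measures the inequality in one direction suffices. -/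
theorem levyProkhorovEDist_le_of_cells {Ω ι : Type*} [Fintype ι] [MeasurableSpace Ω]
    [PseudoMetricSpace Ω] [OpensMeasurableSpace Ω] {μ ρ : Measure Ω} [IsProbabilityMeasure μ]
    [IsProbabilityMeasure ρ] {C D : ι → Set Ω} {δ : ℝ} {η : ENNReal}
    (hC : μ (⋃ i, C i)ᶜ = 0) (hD : ∀ i, MeasurableSet (D i))
    (hdisj : Pairwise (Function.onFun Disjoint D))
    (hdist : ∀ i, ∀ x ∈ C i, ∀ y ∈ D i, dist x y ≤ δ)
    (hη : ∀ i, μ (C i) ≤ ρ (D i) + η) (hsum : Fintype.card ι * η ≤ ENNReal.ofReal δ) :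
    levyProkhorovEDist μ ρ ≤ ENNReal.ofReal δ := by
  classical
  refine levyProkhorovEDist_le_of_forall_le μ ρ _ fun ε B hε hε' _ => ?_
  have hδ : δ < ε.toReal := by
    by_contra! h
    exact hε.not_ge (by simpa [hε'.ne] using ENNReal.ofReal_le_ofReal h)
  set s : Finset ι := Finset.univ.filter fun i => (C i ∩ B).Nonempty
  calc μ B ≤ μ ((⋃ i ∈ s, C i) ∪ (⋃ i, C i)ᶜ) := by
        refine measure_mono fun x hx => ?_
        by_cases h : x ∈ ⋃ i, C i
        · obtain ⟨i, hi⟩ := mem_iUnion.1 h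
          exact Or.inl (mem_iUnion₂.2 ⟨i, by simpa [s] using ⟨x, hi, hx⟩, hi⟩)
        · exact Or.inr h
    _ ≤ μ (⋃ i ∈ s, C i) + μ (⋃ i, C i)ᶜ := measure_union_le _ _
    _ = μ (⋃ i ∈ s, C i) := by rw [hC, add_zero]
    _ ≤ ∑ i ∈ s, μ (C i) := measure_biUnion_finset_le _ _
    _ ≤ ∑ i ∈ s, (ρ (D i) + η) := Finset.sum_le_sum fun i _ => hη i
    _ = ρ (⋃ i ∈ s, D i) + s.card * η := by
        rw [Finset.sum_add_distrib, measure_biUnion_finset (fun i _ j _ h => hdisj h)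
          fun i _ => hD i]
        simp
    _ ≤ ρ (Metric.thickening ε.toReal B) + ε := by
        refine add_le_add (measure_mono (iUnion₂_subset fun i hi y hy => ?_)) ?_
        · obtain ⟨x, hx, hxB⟩ := (Finset.mem_filter.1 hi).2
          exact Metric.mem_thickening_iff.2 ⟨x, hxB, by
            rw [dist_comm]; exact (hdist i x hx y hy).trans_lt hδ⟩
        · refine le_trans ?_ (hsum.trans hε.le)
          gcongr
          exact s.card_le_univ

/-! ### Selections with prescribed block counts. -/

theorem mul_add_bounds {r q m i u : ℕ} (hi : i < r) (hu : u < q) (hq : r * q ≤ m) :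
    i * q ≤ i * q + u ∧ i * q + u < (i + 1) * q ∧ i * q + u < m := by
  have h : (i + 1) * q ≤ r * q := Nat.mul_le_mul_right q hi
  refine ⟨by omega, ?_, ?_⟩ <;> nlinarith

theorem mul_add_inj {q i i' u u' : ℕ} (hu : u < q) (hu' : u' < q)
    (h : i * q + u = i' * q + u') : i = i' ∧ u = u' := by
  have hq : 0 < q := by omega
  have e1 : (i * q + u) / q = i := by
    rw [mul_comm, Nat.mul_add_div hq, Nat.div_eq_of_lt hu, add_zero]
  have e2 : (i' * q + u') / q = i' := by
    rw [mul_comm, Nat.mul_add_div hq, Nat.div_eq_of_lt hu', add_zero]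
  have e : i = i' := by rw [← e1, h, e2]
  subst e
  exact ⟨rfl, by omega⟩

/-- The row and column sums fit into blocks of `q` positions and `p` values, so the prescribed
points can be given distinct positions and distinct values separately. This partial injection
extends to a permutation of `Fin n`, which is then restricted to the first `m` positions. -/
theorem exists_embedding_of_counts {r p q m n : ℕ} (c : Fin r → Fin r → ℕ)
    (hrow : ∀ i, ∑ j, c i j ≤ q) (hcol : ∀ j, ∑ i, c i j ≤ p) (hq : r * q ≤ m) (hp : r * p ≤ n)
    (hmn : m ≤ n) : ∃ (ν : Fin m ↪ Fin n) (a : (Σ ij : Fin r × Fin r, Fin (c ij.1 ij.2)) → Fin m),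
      Function.Injective a ∧ ∀ t,
        ((t.1.1 : ℕ) * q ≤ a t ∧ a t < ((t.1.1 : ℕ) + 1) * q) ∧
        ((t.1.2 : ℕ) * p ≤ ν (a t) ∧ ν (a t) < ((t.1.2 : ℕ) + 1) * p) := by
  have hf (i : Fin r) : Nonempty ((Σ j, Fin (c i j)) ↪ Fin q) :=
    Function.Embedding.nonempty_of_card_le (by simpa using hrow i)
  have hg (j : Fin r) : Nonempty ((Σ i, Fin (c i j)) ↪ Fin p) :=
    Function.Embedding.nonempty_of_card_le (by simpa using hcol j)
  let f (i : Fin r) := (hf i).some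
  let g (j : Fin r) := (hg j).some
  let a : (Σ ij : Fin r × Fin r, Fin (c ij.1 ij.2)) → Fin m := fun t =>
    ⟨(t.1.1 : ℕ) * q + f t.1.1 ⟨t.1.2, t.2⟩, (mul_add_bounds t.1.1.2 (Fin.is_lt _) hq).2.2⟩
  let b : (Σ ij : Fin r × Fin r, Fin (c ij.1 ij.2)) → Fin n := fun t =>
    ⟨(t.1.2 : ℕ) * p + g t.1.2 ⟨t.1.1, t.2⟩, (mul_add_bounds t.1.2.2 (Fin.is_lt _) hp).2.2⟩
  have ha : Function.Injective a := by
    rintro ⟨⟨i, j⟩, s⟩ ⟨⟨i', j'⟩, s'⟩ h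
    obtain ⟨h1, h2⟩ := mul_add_inj (Fin.is_lt _) (Fin.is_lt _) (Fin.mk.inj h)
    obtain rfl : i = i' := Fin.ext h1
    have := (f i).injective (Fin.ext h2)
    cases this
    rfl
  have hb : Function.Injective b := by
    rintro ⟨⟨i, j⟩, s⟩ ⟨⟨i', j'⟩, s'⟩ h
    obtain ⟨h1, h2⟩ := mul_add_inj (Fin.is_lt _) (Fin.is_lt _) (Fin.mk.inj h)
    obtain rfl : j = j' := Fin.ext h1
    have := (g j).injective (Fin.ext h2)
    cases this
    rfl
  obtain ⟨σ, hσ⟩ := Equiv.Perm.exists_extending_pair (fun t => Fin.castLE hmn (a t)) b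
    ((Fin.castLE_injective hmn).comp ha) hb
  refine ⟨(Fin.castLEEmb hmn).trans σ.toEmbedding, a, ha, fun t => ⟨?_, ?_⟩⟩
  · have := mul_add_bounds t.1.1.2 (Fin.is_lt (f t.1.1 ⟨t.1.2, t.2⟩)) hq
    exact ⟨this.1, this.2.1⟩
  · have := mul_add_bounds t.1.2.2 (Fin.is_lt (g t.1.2 ⟨t.1.1, t.2⟩)) hp
    have e : ((Fin.castLEEmb hmn).trans σ.toEmbedding) (a t) = b t := hσ t
    rw [e]
    exact ⟨this.1, this.2.1⟩

/-! ### Comparing real intervals with blocks of grid indices. -/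

/-- Rounding shifts an end of a block by at most `r / n ≤ 1 / r`, which is where `r ^ 2 ≤ n` enters,
and the interval itself has length at most `1 / r`. It serves abscissas with `α = lam`, `M = m` and
ordinates with `α = 1`, `M = n`. -/
theorem abs_sub_le_of_grid {α : ℝ} {r n M i h : ℕ} (h0 : 0 ≤ α) (h1 : α ≤ 1) (hr : 0 < r)
    (hn : r ^ 2 ≤ n) (hM : α * n ≤ M) (hM' : M ≤ α * n + 1) (hi : i < r) {x z : ℝ}
    (hx : x ∈ Ioc (i * (α / r)) ((i + 1) * (α / r))) (hh : i * (M / r) ≤ h)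
    (hh' : h < (i + 1) * (M / r)) (hz : z ∈ Ico ((h : ℝ) / n) (((h : ℝ) + 1) / n)) :
    |x - z| ≤ 2 / r := by
  have hr' : (1 : ℝ) ≤ r := by exact_mod_cast hr
  have hn' : (r : ℝ) ^ 2 ≤ n := by exact_mod_cast hn
  have hn0 : (0 : ℝ) < n := lt_of_lt_of_le (by positivity) hn'
  have hi' : (i : ℝ) + 1 ≤ r := by exact_mod_cast hi
  have hi0 : (0 : ℝ) ≤ i := i.cast_nonneg
  set q := M / r
  have hq1 : (r : ℝ) * q ≤ M := by exact_mod_cast Nat.mul_div_le M r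
  have hq2 : (M : ℝ) ≤ r * (q + 1) := by exact_mod_cast (Nat.lt_mul_div_succ M hr).le
  have hh1 : (i : ℝ) * q ≤ h := by exact_mod_cast hh
  have hh2 : (h : ℝ) + 1 ≤ (i + 1) * q := by exact_mod_cast hh'
  obtain ⟨w, rfl⟩ : ∃ w, α = r * w := ⟨α / r, by field_simp⟩
  rw [mul_div_cancel_left₀ _ (by positivity)] at hx
  have hw : w ≤ 1 / r := by rw [le_div_iff₀ (by positivity)]; linarith
  have hw1 : w * n ≤ q + 1 := by
    refine le_of_mul_le_mul_left ?_ (by positivity : (0 : ℝ) < r)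
    linarith
  have hw2 : (q : ℝ) ≤ w * n + 1 := by
    refine le_of_mul_le_mul_left ?_ (by positivity : (0 : ℝ) < r)
    linarith
  have hz1 : (h : ℝ) ≤ z * n := (div_le_iff₀ hn0).1 hz.1
  have hz2 : z * n ≤ (h : ℝ) + 1 := ((lt_div_iff₀ hn0).1 hz.2).le
  have hrn : (r : ℝ) ≤ 1 / r * n := by
    rw [div_mul_eq_mul_div, one_mul, le_div_iff₀ (by positivity)]
    linarith
  have hl : i * w - 1 / r ≤ z := by
    refine le_of_mul_le_mul_right ?_ hn0
    have := mul_le_mul_of_nonneg_left hw1 hi0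
    linarith
  have hu : z ≤ (i + 1) * w + 1 / r := by
    refine le_of_mul_le_mul_right ?_ hn0
    have := mul_le_mul_of_nonneg_left hw2 (by positivity : (0 : ℝ) ≤ i + 1)
    linarith
  have h2 : (2 : ℝ) / r = 1 / r + 1 / r := by ring
  rw [h2, abs_le]
  constructor <;> linarith [hx.1, hx.2]

theorem exists_mem_Ioc_grid {α x : ℝ} {r : ℕ} (hr : 0 < r) (h0 : 0 < x) (hα : x ≤ α) :
    ∃ i : Fin r, x ∈ Ioc ((i : ℝ) * (α / r)) (((i : ℝ) + 1) * (α / r)) := by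
  have hr' : (0 : ℝ) < r := by exact_mod_cast hr
  have hw : 0 < α / r := div_pos (h0.trans_le hα) hr'
  have hc : 0 < ⌈x / (α / r)⌉₊ := Nat.ceil_pos.2 (div_pos h0 hw)
  have hcr : ⌈x / (α / r)⌉₊ ≤ r := by
    refine Nat.ceil_le.2 ((div_le_iff₀ hw).2 ?_)
    rwa [mul_div_cancel₀ _ hr'.ne']
  obtain ⟨i, hi⟩ : ∃ i, ⌈x / (α / r)⌉₊ = i + 1 := Nat.exists_eq_succ_of_ne_zero hc.ne'
  refine ⟨⟨i, by omega⟩, ?_, ?_⟩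
  · exact (lt_div_iff₀ hw).1 (Nat.lt_ceil.1 (show i < _ by omega))
  · have := (div_le_iff₀ hw).1 (Nat.le_ceil (x / (α / r)))
    rw [hi] at this
    exact_mod_cast this

/-! ### Marginals and cell masses of a `lam`-permuton. -/

theorem measureReal_preimage_Ioc {Ω : Type*} [MeasurableSpace Ω] (μ : Measure Ω)
    [IsProbabilityMeasure μ] {f : Ω → ℝ} (hf : Measurable f) {a b : ℝ} (hab : a ≤ b) :
    μ.real (f ⁻¹' Ioc a b) = cdf (μ.map f) b - cdf (μ.map f) a := by
  have : IsProbabilityMeasure (μ.map f) := Measure.isProbabilityMeasure_map hf.aemeasurable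
  rw [cdf_eq_real, cdf_eq_real, ← measureReal_sdiff (Iic_subset_Iic.2 hab) measurableSet_Iic,
    Iic_sdiff_Iic, map_measureReal_apply hf measurableSet_Ioc]

namespace IsLambdaPermuton

variable {lam : ℝ} {μ : Measure (ℝ × ℝ)}

theorem marginalX_continuous (hμ : IsLambdaPermuton lam μ) : Continuous (marginalX μ) := by
  have hl := hμ.lam_pos
  have hmono : Monotone (marginalX μ) := monotone_cdf _
  -- Outside `[0, lam]` the values are forced by monotonicity and the bounds `0` and `1`.
  have : marginalX μ = fun x => max 0 (min 1 (x / lam)) := by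
    funext x
    rcases lt_or_ge x 0 with h | h
    · have h1 : marginalX μ x ≤ 0 := by
        simpa [hμ.marginalX_eq 0 ⟨le_rfl, hl.le⟩] using hmono h.le
      rw [le_antisymm h1 (cdf_nonneg _ _), max_eq_left]
      exact (min_le_right _ _).trans (div_nonpos_of_nonpos_of_nonneg h.le hl.le)
    rcases le_or_gt x lam with h' | h'
    · rw [hμ.marginalX_eq x ⟨h, h'⟩, min_eq_right ((div_le_one hl).2 h'),
        max_eq_right (by positivity)]
    · have h1 : 1 ≤ marginalX μ x := by
        simpa [hμ.marginalX_eq lam ⟨hl.le, le_rfl⟩, hl.ne'] using hmono h'.le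
      rw [show marginalX μ x = 1 from le_antisymm (cdf_le_one _ _) h1, min_eq_left ((one_le_div hl).2 h'.le),
        max_eq_right zero_le_one]
  rw [this]
  fun_prop

theorem nullSingletonClass_fst (hμ : IsLambdaPermuton lam μ) :
    NullSingletonClass (μ.map Prod.fst) := by
  have := hμ.isProbabilityMeasure
  have : IsProbabilityMeasure (μ.map Prod.fst) :=
    Measure.isProbabilityMeasure_map measurable_fst.aemeasurable
  exact nullSingletonClass_of_continuous_cdf _ hμ.marginalX_continuous

theorem nullSingletonClass_snd (hμ : IsLambdaPermuton lam μ) :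
    NullSingletonClass (μ.map Prod.snd) := by
  have := hμ.isProbabilityMeasure
  have : IsProbabilityMeasure (μ.map Prod.snd) :=
    Measure.isProbabilityMeasure_map measurable_snd.aemeasurable
  exact nullSingletonClass_of_continuous_cdf _ hμ.marginalY_continuous

theorem measure_compl_Ioc_prod_Ioc (hμ : IsLambdaPermuton lam μ) :
    μ (Ioc 0 lam ×ˢ Ioc 0 1)ᶜ = 0 := by
  have h1 : μ (Prod.fst ⁻¹' {(0 : ℝ)}) = 0 := by
    rw [← Measure.map_apply measurable_fst (measurableSet_singleton _)]
    exact hμ.nullSingletonClass_fst.measure_singleton 0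
  have h2 : μ (Prod.snd ⁻¹' {(0 : ℝ)}) = 0 := by
    rw [← Measure.map_apply measurable_snd (measurableSet_singleton _)]
    exact hμ.nullSingletonClass_snd.measure_singleton 0
  refine measure_mono_null ?_ (measure_union_null hμ.concentrated (measure_union_null h1 h2))
  rintro ⟨x, y⟩ h
  by_contra hc
  simp only [mem_union, mem_compl_iff, mem_prod, mem_Icc, mem_preimage, mem_singleton_iff,
    not_or, not_not] at hc
  exact h ⟨⟨lt_of_le_of_ne hc.1.1.1 (Ne.symm hc.2.1), hc.1.1.2⟩,
    ⟨lt_of_le_of_ne hc.1.2.1 (Ne.symm hc.2.2), hc.1.2.2⟩⟩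

end IsLambdaPermuton

theorem sum_measureReal_le_of_subset {Ω ι : Type*} [Fintype ι] [MeasurableSpace Ω] (μ : Measure Ω)
    [IsFiniteMeasure μ] {C : ι → Set Ω} {S : Set Ω} (hC : ∀ i, MeasurableSet (C i))
    (hdisj : Pairwise (Function.onFun Disjoint C)) (hS : ∀ i, C i ⊆ S) :
    ∑ i, μ.real (C i) ≤ μ.real S := by
  rw [← measureReal_biUnion_finset (fun i _ j _ h => hdisj h) fun i _ => hC i]
  exact measureReal_mono (iUnion₂_subset fun i _ => hS i)

/-- Cell `(i, j)` of the subdivision of `(0, α] × (0, 1]` into `r ^ 2` congruent cells. -/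
def gridCell (α : ℝ) (r : ℕ) (i j : Fin r) : Set (ℝ × ℝ) :=
  Ioc ((i : ℝ) * (α / r)) (((i : ℝ) + 1) * (α / r)) ×ˢ
    Ioc ((j : ℝ) * (1 / r)) (((j : ℝ) + 1) * (1 / r))

theorem measurableSet_gridCell (α : ℝ) (r : ℕ) (i j : Fin r) : MeasurableSet (gridCell α r i j) :=
  measurableSet_Ioc.prod measurableSet_Ioc

theorem disjoint_Ioc_mul {w : ℝ} (hw : 0 ≤ w) {i j : ℕ} (hij : i ≠ j) :
    Disjoint (Ioc ((i : ℝ) * w) (((i : ℝ) + 1) * w)) (Ioc ((j : ℝ) * w) (((j : ℝ) + 1) * w)) := by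
  have key {a b : ℕ} (h : a < b) : ((a : ℝ) + 1) * w ≤ b * w := by
    have : (a : ℝ) + 1 ≤ b := by exact_mod_cast h
    gcongr
  refine Set.disjoint_left.2 fun x hx hx' => ?_
  rcases hij.lt_or_gt with h | h
  · linarith [hx.2, hx'.1, key h]
  · linarith [hx'.2, hx.1, key h]

theorem measure_compl_iUnion_gridCell {lam : ℝ} {μ : Measure (ℝ × ℝ)} (hμ : IsLambdaPermuton lam μ)
    {r : ℕ} (hr : 0 < r) : μ (⋃ ij : Fin r × Fin r, gridCell lam r ij.1 ij.2)ᶜ = 0 := by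
  refine measure_mono_null (compl_subset_compl.2 ?_) hμ.measure_compl_Ioc_prod_Ioc
  rintro ⟨x, y⟩ ⟨hx, hy⟩
  obtain ⟨i, hi⟩ := exists_mem_Ioc_grid hr hx.1 hx.2
  obtain ⟨j, hj⟩ := exists_mem_Ioc_grid hr hy.1 hy.2
  exact mem_iUnion.2 ⟨(i, j), hi, hj⟩

theorem sum_row_gridCell_le {lam : ℝ} {μ : Measure (ℝ × ℝ)} (hμ : IsLambdaPermuton lam μ)
    {r : ℕ} (i : Fin r) : ∑ j, μ.real (gridCell lam r i j) ≤ 1 / r := by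
  have := hμ.isProbabilityMeasure
  have hl := hμ.lam_pos
  have hr : (0 : ℝ) < r := by exact_mod_cast i.pos
  have hi : (i : ℝ) + 1 ≤ r := by exact_mod_cast i.2
  refine (sum_measureReal_le_of_subset μ
    (S := Prod.fst ⁻¹' Ioc ((i : ℝ) * (lam / r)) (((i : ℝ) + 1) * (lam / r)))
    (fun j => measurableSet_gridCell _ _ _ _) (fun j j' h => ?_) fun j p hp => hp.1).trans ?_
  · exact Disjoint.set_prod_right
      (disjoint_Ioc_mul (by positivity) (fun e => h (Fin.ext e))) _ _
  · rw [measureReal_preimage_Ioc μ measurable_fst (by gcongr; linarith)]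
    have h1 := hμ.marginalX_eq ((i : ℝ) * (lam / r)) ⟨by positivity, by
      rw [mul_div_assoc', div_le_iff₀ hr]; nlinarith⟩
    have h2 := hμ.marginalX_eq (((i : ℝ) + 1) * (lam / r)) ⟨by positivity, by
      rw [mul_div_assoc', div_le_iff₀ hr]; nlinarith⟩
    unfold marginalX at h1 h2
    rw [h1, h2]
    apply le_of_eq
    field_simp
    ring

theorem sum_column_gridCell_le {lam : ℝ} {μ : Measure (ℝ × ℝ)} (hμ : IsLambdaPermuton lam μ)
    {r : ℕ} (j : Fin r) : ∑ i, μ.real (gridCell lam r i j) ≤ 1 / r / lam := by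
  have := hμ.isProbabilityMeasure
  have hl := hμ.lam_pos
  have hr : (0 : ℝ) < r := by exact_mod_cast j.pos
  have hj : (j : ℝ) + 1 ≤ r := by exact_mod_cast j.2
  refine (sum_measureReal_le_of_subset μ
    (S := Prod.snd ⁻¹' Ioc ((j : ℝ) * (1 / r)) (((j : ℝ) + 1) * (1 / r)))
    (fun i => measurableSet_gridCell _ _ _ _) (fun i i' h => ?_) fun i p hp => hp.2).trans ?_
  · exact Disjoint.set_prod_left
      (disjoint_Ioc_mul (by positivity) (fun e => h (Fin.ext e))) _ _
  · have hlt : (j : ℝ) * (1 / r) < ((j : ℝ) + 1) * (1 / r) := by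
      gcongr; linarith
    rw [measureReal_preimage_Ioc μ measurable_snd hlt.le]
    refine (hμ.marginalY_slope _ _ (by positivity) hlt ?_).trans (le_of_eq ?_)
    · rw [mul_one_div, div_le_iff₀ hr]; linarith
    · ring

/-! ### The approximating selections. -/

theorem sum_floor_mul_le {ι : Type*} [Fintype ι] {x : ι → ℝ} {N s : ℝ} {M : ℕ} (hN : 0 ≤ N)
    (hx : ∀ i, 0 ≤ x i) (hs : ∑ i, x i ≤ s) (hM : N * s ≤ M) : ∑ i, ⌊N * x i⌋₊ ≤ M := by
  have : (∑ i, (⌊N * x i⌋₊ : ℝ)) ≤ M := calc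
    ∑ i, (⌊N * x i⌋₊ : ℝ) ≤ ∑ i, N * x i :=
      Finset.sum_le_sum fun i _ => Nat.floor_le (mul_nonneg hN (hx i))
    _ = N * ∑ i, x i := (Finset.mul_sum _ _ _).symm
    _ ≤ N * s := mul_le_mul_of_nonneg_left hs hN
    _ ≤ M := hM
  exact_mod_cast this

theorem ceil_mul_le {lam : ℝ} (h : lam ≤ 1) (n : ℕ) : ⌈lam * n⌉₊ ≤ n :=
  Nat.ceil_le.2 (mul_le_of_le_one_left n.cast_nonneg h)

theorem exists_selection_levyProkhorovEDist_le {lam : ℝ} {μ : Measure (ℝ × ℝ)}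
    (hμ : IsLambdaPermuton lam μ) {r n : ℕ} (hr : 0 < r) (hn : r ^ 2 ≤ n) {δ : ℝ}
    (h2 : 2 / r ≤ δ) (hδ : (r : ℝ) ^ 2 * ((r + 2) / ⌈lam * n⌉₊) ≤ δ) :
    ∃ ν : OrderedSelection n ⌈lam * n⌉₊,
      levyProkhorovEDist μ (selectionPermuton ν) ≤ ENNReal.ofReal δ := by
  classical
  have := hμ.isProbabilityMeasure
  have hl := hμ.lam_pos
  have hn0 : 0 < n := lt_of_lt_of_le (by positivity) hn
  have hr' : (0 : ℝ) < r := by exact_mod_cast hr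
  have hmn : ⌈lam * n⌉₊ ≤ n := ceil_mul_le hμ.lam_le_one n
  have hm1 : lam * n ≤ ⌈lam * n⌉₊ := Nat.le_ceil _
  have hm2 : (⌈lam * n⌉₊ : ℝ) < lam * n + 1 := Nat.ceil_lt_add_one (by positivity)
  have hm0 : 0 < ⌈lam * n⌉₊ := Nat.ceil_pos.2 (by positivity)
  set m := ⌈lam * n⌉₊
  have hm0' : (0 : ℝ) < m := by exact_mod_cast hm0
  have hq : (m : ℝ) ≤ r * ((m / r : ℕ) + 1) := by exact_mod_cast (Nat.lt_mul_div_succ m hr).le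
  have hp : (n : ℝ) ≤ r * ((n / r : ℕ) + 1) := by exact_mod_cast (Nat.lt_mul_div_succ n hr).le
  -- The largest scale for which the strip masses, times `N`, fit into blocks of `m / r` positions
  -- and `n / r` values.
  set N : ℝ := r * min ((m / r : ℕ) : ℝ) (lam * (n / r : ℕ))
  have hN0 : 0 ≤ N := by positivity
  have hNm : (m : ℝ) - 1 - r ≤ N := by
    have hlr : lam * r ≤ r := mul_le_of_le_one_left hr'.le hμ.lam_le_one
    have := mul_le_mul_of_nonneg_left hp hl.le
    simp only [N, mul_min_of_nonneg _ _ hr'.le]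
    refine le_min ?_ ?_ <;> linarith
  have hNq : N * (1 / r) ≤ (m / r : ℕ) := by
    rw [mul_one_div, div_le_iff₀ hr', mul_comm]
    exact mul_le_mul_of_nonneg_left (min_le_left _ _) hr'.le
  have hNp : N * (1 / r / lam) ≤ (n / r : ℕ) := by
    rw [div_div, mul_one_div, div_le_iff₀ (by positivity)]
    calc N ≤ r * (lam * (n / r : ℕ)) :=
          mul_le_mul_of_nonneg_left (min_le_right _ _) hr'.le
      _ = _ := by ring
  obtain ⟨ν, a, ha, hν⟩ := exists_embedding_of_counts (r := r) (p := n / r) (q := m / r) (m := m)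
    (n := n) (fun i j => ⌊N * μ.real (gridCell lam r i j)⌋₊)
    (fun i => sum_floor_mul_le hN0 (fun _ => measureReal_nonneg) (sum_row_gridCell_le hμ i) hNq)
    (fun j => sum_floor_mul_le hN0 (fun _ => measureReal_nonneg) (sum_column_gridCell_le hμ j) hNp)
    (Nat.mul_div_le _ _) (Nat.mul_div_le _ _) hmn
  have := isProbabilityMeasure_selectionPermuton hn0.ne' hm0.ne' ν
  let S (ij : Fin r × Fin r) : Finset (Fin m) := Finset.univ.image fun s => a ⟨ij, s⟩
  have hScard (ij : Fin r × Fin r) :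
      (S ij).card = ⌊N * μ.real (gridCell lam r ij.1 ij.2)⌋₊ := by
    refine (Finset.card_image_of_injective _ (ha.comp sigma_mk_injective)).trans ?_
    simp
  refine ⟨ν, levyProkhorovEDist_le_of_cells
    (C := fun ij : Fin r × Fin r => gridCell lam r ij.1 ij.2)
    (D := fun ij => ⋃ h ∈ S ij, gridSquare n h (ν h)) (η := ENNReal.ofReal ((r + 2) / m))
    (measure_compl_iUnion_gridCell hμ hr)
    (fun ij => Finset.measurableSet_biUnion _ fun h _ => measurableSet_gridSquare _ _ _)
    ?_ ?_ ?_ ?_⟩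
  · intro ij ij' hne
    refine Set.disjoint_left.2 fun p hp hp' => hne ?_
    obtain ⟨h, hh, hph⟩ := mem_iUnion₂.1 hp
    obtain ⟨h', hh', hph'⟩ := mem_iUnion₂.1 hp'
    obtain rfl : h = h' := Fin.ext (fst_eq_of_mem_gridSquare hph hph')
    obtain ⟨s, -, hs⟩ := Finset.mem_image.1 hh
    obtain ⟨s', -, hs'⟩ := Finset.mem_image.1 hh'
    exact congrArg Sigma.fst (ha (hs.trans hs'.symm))
  · intro ij x hx y hy
    obtain ⟨h, hh, hyh⟩ := mem_iUnion₂.1 hy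
    obtain ⟨s, -, rfl⟩ := Finset.mem_image.1 hh
    obtain ⟨h1, h3⟩ := hν ⟨ij, s⟩
    rw [Prod.dist_eq, Real.dist_eq, Real.dist_eq]
    refine (max_le ?_ ?_).trans h2
    · exact abs_sub_le_of_grid hl.le hμ.lam_le_one hr hn hm1 hm2.le ij.1.2 hx.1 h1.1 h1.2 hyh.1
    · exact abs_sub_le_of_grid (α := 1) zero_le_one le_rfl hr hn (by simp) (by simp) ij.2.2 hx.2
        h3.1 h3.2 hyh.2
  · intro ij
    rw [selectionPermuton_biUnion_gridSquare hn0.ne', hScard]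
    set x := μ.real (gridCell lam r ij.1 ij.2)
    have hx1 : x ≤ 1 := measureReal_le_one
    have hx0 : 0 ≤ x := measureReal_nonneg
    have hf : N * x < ⌊N * x⌋₊ + 1 := Nat.lt_floor_add_one _
    -- The shortfall of `N` from `m` costs at most `r + 1` points in a cell and the floor at most
    -- one more, hence `r + 2`.
    have key : x ≤ ⌊N * x⌋₊ * (m : ℝ)⁻¹ + (r + 2) / m := by
      rw [← div_eq_mul_inv, ← add_div, le_div_iff₀ hm0']
      nlinarith
    calc μ (gridCell lam r ij.1 ij.2) = ENNReal.ofReal x :=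
          (ofReal_measureReal (measure_ne_top _ _)).symm
      _ ≤ ENNReal.ofReal (⌊N * x⌋₊ * (m : ℝ)⁻¹ + (r + 2) / m) := ENNReal.ofReal_le_ofReal key
      _ = _ := by
        rw [ENNReal.ofReal_add (by positivity) (by positivity),
          ENNReal.ofReal_mul (by positivity), ENNReal.ofReal_natCast,
          ENNReal.ofReal_inv_of_pos hm0', ENNReal.ofReal_natCast]
  · refine le_trans (le_of_eq ?_) (ENNReal.ofReal_le_ofReal hδ)
    rw [ENNReal.ofReal_mul (by positivity), ENNReal.ofReal_pow (by positivity),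
      ENNReal.ofReal_natCast, Fintype.card_prod, Fintype.card_fin, sq]
    push_cast
    rfl

theorem tendsto_ceil_mul_atTop {lam : ℝ} (h : 0 < lam) :
    Tendsto (fun n : ℕ => ⌈lam * n⌉₊) atTop atTop :=
  tendsto_nat_ceil_atTop.comp (tendsto_natCast_atTop_atTop.const_mul_atTop h)

theorem exists_selections_tendsto_levyProkhorovEDist {lam : ℝ} {μ : Measure (ℝ × ℝ)}
    (hμ : IsLambdaPermuton lam μ) : ∃ ν : ∀ n : ℕ, OrderedSelection n ⌈lam * n⌉₊,
      Tendsto (fun n => levyProkhorovEDist (selectionPermuton (ν n)) μ) atTop (𝓝 0) := by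
  -- For each `n` a closest selection is chosen among the finitely many, so that one sequence works
  -- for every precision `δ` and grid size `r`.
  have hmin (n : ℕ) : ∃ ν : OrderedSelection n ⌈lam * n⌉₊, ∀ ν',
      levyProkhorovEDist μ (selectionPermuton ν) ≤ levyProkhorovEDist μ (selectionPermuton ν') :=
    have : Nonempty (OrderedSelection n ⌈lam * n⌉₊) :=
      ⟨Fin.castLEEmb (ceil_mul_le hμ.lam_le_one n)⟩
    Finite.exists_min _
  choose ν hν using hmin
  refine ⟨ν, ENNReal.tendsto_nhds_zero.2 fun ε hε => ?_⟩
  obtain ⟨δ, hδ, hδε⟩ : ∃ δ : ℝ, 0 < δ ∧ ENNReal.ofReal δ ≤ ε := by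
    obtain ⟨δ, hδ, hlt⟩ := ENNReal.lt_iff_exists_nnreal_btwn.1 hε
    exact ⟨δ, by exact_mod_cast hδ, by simpa using hlt.le⟩
  obtain ⟨r, hr⟩ := exists_nat_gt (2 / δ)
  have hr0 : (0 : ℝ) < r := (by positivity : 0 < 2 / δ).trans hr
  have hlim : Tendsto (fun n : ℕ => (r : ℝ) ^ 2 * ((r + 2) / ⌈lam * n⌉₊)) atTop (𝓝 0) := by
    have := ((tendsto_natCast_atTop_atTop (R := ℝ)).comp
      (tendsto_ceil_mul_atTop hμ.lam_pos)).const_div_atTop ((r : ℝ) + 2)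
    simpa using this.const_mul ((r : ℝ) ^ 2)
  filter_upwards [hlim.eventually_le_const hδ, eventually_ge_atTop (r ^ 2)] with n h1 h2
  obtain ⟨ν', hν'⟩ := exists_selection_levyProkhorovEDist_le hμ (by exact_mod_cast hr0) h2
    ((div_le_iff₀ hr0).2 (by rw [mul_comm]; exact ((div_lt_iff₀ hδ).1 hr).le)) h1
  rw [levyProkhorovEDist_comm]
  exact ((hν n ν').trans hν').trans hδε

/-! ### Conclusion. -/

theorem tendsto_of_tendsto_levyProkhorovEDist {Ω ι : Type*} [MeasurableSpace Ω]
    [PseudoMetricSpace Ω] [OpensMeasurableSpace Ω] {l : Filter ι} {μs : ι → ProbabilityMeasure Ω}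
    {μ : ProbabilityMeasure Ω}
    (h : Tendsto (fun i => levyProkhorovEDist (μs i : Measure Ω) (μ : Measure Ω)) l (𝓝 0)) :
    Tendsto μs l (𝓝 μ) := by
  have : Tendsto (fun i => LevyProkhorov.ofMeasure (μs i)) l (𝓝 (LevyProkhorov.ofMeasure μ)) :=
    tendsto_iff_edist_tendsto_0.2 h
  exact (LevyProkhorov.continuous_toMeasure_probabilityMeasure.tendsto _).comp this

theorem mainTheorem2 (lam : ℝ) (μ : Measure (ℝ × ℝ)) (hμ : IsLambdaPermuton lam μ) :
    ∃ (m : ℕ → ℕ) (ν : ∀ n, OrderedSelection n (m n)),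
      (∀ n, 1 ≤ n → 1 ≤ m n ∧ m n ≤ n) ∧ SelectionTendsto ν lam μ := by
  obtain ⟨μ, rfl⟩ : ∃ μ' : ProbabilityMeasure (ℝ × ℝ), (μ' : Measure (ℝ × ℝ)) = μ :=
    ⟨⟨μ, hμ.isProbabilityMeasure⟩, rfl⟩
  have := hμ.nullSingletonClass_fst
  have := hμ.nullSingletonClass_snd
  have hl := hμ.lam_pos
  obtain ⟨ν, hν⟩ := exists_selections_tendsto_levyProkhorovEDist hμ
  have hm0 : ∀ n : ℕ, 1 ≤ n → 1 ≤ ⌈lam * n⌉₊ := fun n hn =>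
    Nat.ceil_pos.2 (mul_pos hl (by exact_mod_cast hn))
  have hm := tendsto_ceil_mul_atTop hl
  -- For `n = 0` the selection gives the zero measure, so `μ` itself stands in as a dummy value.
  have hP : ∀ n : ℕ, ∃ ρ : ProbabilityMeasure (ℝ × ℝ), 1 ≤ n →
      (ρ : Measure (ℝ × ℝ)) = selectionPermuton (ν n) := fun n => by
    rcases n.eq_zero_or_pos with rfl | hn
    · exact ⟨μ, by simp⟩
    · exact ⟨⟨selectionPermuton (ν n), isProbabilityMeasure_selectionPermuton hn.ne'
        (Nat.pos_iff_ne_zero.1 (hm0 n hn)) (ν n)⟩, fun _ => rfl⟩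
  choose ρ hρ using hP
  have hev : ∀ᶠ n : ℕ in atTop, (ρ n : Measure (ℝ × ℝ)) = selectionPermuton (ν n) :=
    (eventually_ge_atTop 1).mono hρ
  have hlim : Tendsto ρ atTop (𝓝 μ) :=
    tendsto_of_tendsto_levyProkhorovEDist (hν.congr' (hev.mono fun n hn => by
      simp only [hn]))
  have hdens (k : ℕ) (τ : Equiv.Perm (Fin k)) :
      Tendsto (fun n => permutonDensity τ (selectionPermuton (ν n))) atTop
        (𝓝 (permutonDensity τ (μ : Measure (ℝ × ℝ)))) :=
    (tendsto_permutonDensity hlim τ).congr' (hev.mono fun n hn => by simp only [hn])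
  refine ⟨fun n => ⌈lam * n⌉₊, ν, fun n hn => ⟨hm0 n hn, ceil_mul_le hμ.lam_le_one n⟩, hm,
    (tendsto_nat_ceil_mul_div_atTop hl.le).comp tendsto_natCast_atTop_atTop, fun k τ => ?_,
    hdens, fun x _ => ?_, fun x _ => ?_⟩
  · exact tendsto_selectionPatternDensity hm (sum_permutonDensity k (μ : Measure (ℝ × ℝ))) (hdens k) τ
  · exact (tendsto_cdf_map hlim continuous_fst x).congr' (hev.mono fun n hn => by
      simp only [hn, marginalX])
  · exact (tendsto_cdf_map hlim continuous_snd x).congr' (hev.mono fun n hn => by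
      simp only [hn, marginalY])
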